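/- Let $q$ be a prime power and $\mathbb{F}$ a finite field with $q^2$ elements. Let $R=\mathbb{F}[X,Y]/\langle Y^q+Y-X^{q+1}\rangle$ be the coordinate ring of the affine Hermitian curve $H: Y^q+Y=X^{q+1}$ over $\mathbb{F}$, and let $P_1,\dots,P_n$ be the distinct rational points of $H$, that is, all pairs $(\alpha,\beta)\in\mathbb{F}^2$ with $\beta^q+\beta=\alpha^{q+1}$. For $1\le i\le n$ and $\gamma\in\mathbb{F}$ let $\mathfrak{m}_{(P_i,\gamma)}=\{f\in R[z] : f(P_i,\gamma)=0\}$, and for $f\in R[z]$ let $\mathrm{mult}_{(P_i,\gamma)}(f)$ be the largest integer $r\ge 0$ with $f\in\mathfrak{m}_{(P_i,\gamma)}^r$ ($\infty$ if $f=0$). Let $M=[m_{i\gamma}\mid 1\le i\le n,\ \gamma\in\mathbb{F}]$ be a matrix of nonnegative integers (a multiplicity matrix), and let $$I_M=\{f\in R[z] : \mathrm{mult}_{(P_i,\gamma)}(f)\ge m_{i\gamma}\text{ for all }1\le i\le n,\ \gamma\in\mathbb{F}\},$$ an ideal of $R[z]$. Then $R[z]/I_M$ is a finite-dimensional $\mathbb{F}$-vector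 space and $$\dim_{\mathbb{F}} R[z]/I_M=\sum_{i=1}^n\sum_{\gamma\in\mathbb{F}}\binom{m_{i\gamma}+1}{2}.$$ -/

import Mathlib

noncomputable section

namespace Hermitian

variable (F : Type*) [Field F] (q : ℕ)

/-- The defining polynomial `Y ^ q + Y - X ^ (q + 1)` of the affine Hermitian curve `H`, as an
element of `F[X][Y]`: the outer variable is `Y`, the inner one is `X`. -/
def curvePoly : Polynomial (Polynomial F) :=
  Polynomial.X ^ q + Polynomial.X - Polynomial.C (Polynomial.X ^ (q + 1))

/-- The coordinate ring `R = F[X,Y] / ⟨Y ^ q + Y - X ^ (q + 1)⟩` of `H`. -/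
abbrev CoordRing : Type _ := AdjoinRoot (curvePoly F q)

/-- The rational points `(α, β)` of `H`, with coordinates in `F`. -/
abbrev RatPoint : Type _ :=
  {p : F × F // p.2 ^ q + p.2 = p.1 ^ (q + 1)}

variable {F q}

theorem eval_curvePoly (P : RatPoint F q) :
    (curvePoly F q).eval₂ (Polynomial.evalRingHom P.1.1) P.1.2 = 0 := by
  simp only [curvePoly, Polynomial.eval₂_sub, Polynomial.eval₂_add, Polynomial.eval₂_pow,
    Polynomial.eval₂_X, Polynomial.eval₂_C, Polynomial.coe_evalRingHom, Polynomial.eval_pow,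
    Polynomial.eval_X, P.2, sub_self]

/-- The value `f(P)` of a function `f ∈ R` at a rational point `P = (α, β)`, that is, the
homomorphism `R → F` over `F` with `x ↦ α` and `y ↦ β`. -/
def evalAt (P : RatPoint F q) : CoordRing F q →+* F :=
  AdjoinRoot.lift (Polynomial.evalRingHom P.1.1) P.1.2 (eval_curvePoly P)

/-- The value `f(S)` of `f ∈ R[z]` at the rational point `S = (P, γ)` of `V = H × 𝔸¹`. -/
def surfaceEval (P : RatPoint F q) (γ : F) : Polynomial (CoordRing F q) →+* F :=
  Polynomial.eval₂RingHom (evalAt P) γ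

/-- The maximal ideal `𝔪_S = {f ∈ R[z] | f(S) = 0}` of the point `S = (P, γ)`. -/
def maxIdeal (P : RatPoint F q) (γ : F) : Ideal (Polynomial (CoordRing F q)) :=
  RingHom.ker (surfaceEval P γ)

/-- The multiplicity of `f` at `S = (P, γ)`: the supremum (in `ℕ ∪ {∞}`, so that `0` has
multiplicity `∞`) of the integers `r` such that `f ∈ 𝔪_S ^ r`. -/
def mult (P : RatPoint F q) (γ : F) (f : Polynomial (CoordRing F q)) : ℕ∞ :=
  ⨆ r : {r : ℕ // f ∈ maxIdeal P γ ^ r}, (r.1 : ℕ∞)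

theorem le_mult_iff (P : RatPoint F q) (γ : F) (f : Polynomial (CoordRing F q)) (m : ℕ) :
    (m : ℕ∞) ≤ mult P γ f ↔ f ∈ maxIdeal P γ ^ m := by
  constructor
  · intro h
    by_contra hf
    have hlt : ∀ r : ℕ, f ∈ maxIdeal P γ ^ r → r < m := fun r hr => by
      by_contra hmr
      exact hf (Ideal.pow_le_pow_right (not_lt.mp hmr) hr)
    have h0 : 0 < m := hlt 0 (by simp)
    have hle : mult P γ f ≤ ((m - 1 : ℕ) : ℕ∞) :=
      iSup_le fun r => Nat.cast_le.mpr (Nat.le_sub_one_of_lt (hlt r.1 r.2))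
    have := Nat.cast_le.mp (h.trans hle)
    omega
  · intro h
    exact le_iSup (fun r : {r : ℕ // f ∈ maxIdeal P γ ^ r} => (r.1 : ℕ∞)) ⟨m, h⟩

/-- The interpolation ideal `I_M` of a multiplicity matrix `M = [m_{iγ}]`, with respect to the
points `P_1, …, P_n`: all `f ∈ R[z]` of multiplicity at least `m_{iγ}` at every `(P_i, γ)`. -/
def interpIdeal {n : ℕ} (P : Fin n → RatPoint F q) (M : Fin n → F → ℕ) :
    Ideal (Polynomial (CoordRing F q)) where
  carrier := {f | ∀ i γ, (M i γ : ℕ∞) ≤ mult (P i) γ f}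
  add_mem' := by
    intro f g hf hg i γ
    have h1 := (le_mult_iff _ _ _ _).mp (hf i γ)
    have h2 := (le_mult_iff _ _ _ _).mp (hg i γ)
    exact (le_mult_iff _ _ _ _).mpr (Ideal.add_mem _ h1 h2)
  zero_mem' := fun _ _ => (le_mult_iff _ _ _ _).mpr (Ideal.zero_mem _)
  smul_mem' := by
    intro c f hf i γ
    exact (le_mult_iff _ _ _ _).mpr (Ideal.mul_mem_left _ c ((le_mult_iff _ _ _ _).mp (hf i γ)))

end Hermitian

end

/-! At `S = ((α, β), γ)` the ring `R[z]/𝔪_S ^ r` is a copy of `F[s,t]/(s,t) ^ r`, with `s = x - α`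
and `t = z - γ`. The curve is smooth there and `s` is a local parameter; explicitly, `w = y - β`
satisfies the additive equation `w ^ q + w = (α + s) ^ (q + 1) - α ^ (q + 1)`, which is solved
modulo `r`-th powers by an alternating sum of `q ^ i`-th powers of the right side. This yields
`taylor`, which is surjective (`taylor_surjective`) with kernel `𝔪_S ^ r` (`taylor_eq_zero_iff`).
Counting monomials of degree less than `r` gives the binomial coefficient (`finrank_trunc`).
Distinct points have distinct maximal ideals, so the Chinese remainder theorem makes the joint
expansion `multiTaylor` surjective, and its kernel is `I_M`. -/

noncomputable section

namespace Hermitian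

open Polynomial

/-! ### Solving `w ^ q + w = h` modulo powers of an ideal -/

section CommRing

variable {B : Type*} [CommRing B]

/-- The truncated solution `∑_{i < r} (-1) ^ i h ^ (q ^ i)` of `w ^ q + w = h`. -/
def artinSchreierSum (q : ℕ) (h : B) (r : ℕ) : B :=
  ∑ i ∈ Finset.range r, (-1) ^ i * h ^ q ^ i

/-- The `q`-th power shifts the index by one and flips the sign, so the sum telescopes. -/
theorem artinSchreierSum_pow_add {q : ℕ} (hq : q ≠ 0)
    (hadd : ∀ a b : B, (a + b) ^ q = a ^ q + b ^ q) (h : B) (r : ℕ) :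
    artinSchreierSum q h r ^ q + artinSchreierSum q h r = h - (-1) ^ r * h ^ q ^ r := by
  -- Additivity applied to `1 + (-1) = 0` avoids splitting by the parity of `q`.
  have hneg : (-1 : B) ^ q = -1 := by
    have := hadd 1 (-1)
    rw [add_neg_cancel, zero_pow hq, one_pow] at this
    exact (neg_eq_of_add_eq_zero_right this.symm).symm
  induction r with
  | zero => simp [artinSchreierSum, hq]
  | succ r ih =>
    have hs : artinSchreierSum q h (r + 1) = artinSchreierSum q h r + (-1) ^ r * h ^ q ^ r :=
      Finset.sum_range_succ _ _
    have hp : ((-1) ^ r * h ^ q ^ r) ^ q = (-1) ^ r * h ^ q ^ (r + 1) := by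
      rw [mul_pow, ← pow_mul, mul_comm r q, pow_mul, hneg, ← pow_mul, ← pow_succ]
    rw [hs, hadd, hp]
    linear_combination ih

theorem artinSchreierSum_mem {q : ℕ} (hq : q ≠ 0) {I : Ideal B} {h : B} (hI : h ∈ I) (r : ℕ) :
    artinSchreierSum q h r ∈ I :=
  I.sum_mem fun i _ => I.mul_mem_left _ (I.pow_mem_of_mem hI _ (pow_pos (Nat.pos_of_ne_zero hq) i))

theorem pow_mem_pow_of_mem {q : ℕ} (hq : 1 < q) {I : Ideal B} {h : B} (hI : h ∈ I) (r : ℕ) :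
    h ^ q ^ r ∈ I ^ r :=
  Ideal.pow_le_pow_right (Nat.lt_pow_self hq).le (Ideal.pow_mem_pow hI _)

/-- Uniqueness counterpart: any nilpotent solution is forced to equal the sum once `w ^ q ^ r`
vanishes. -/
theorem eq_artinSchreierSum {q : ℕ}
    (hadd : ∀ a b : B, (a + b) ^ q = a ^ q + b ^ q) {w h : B} (hw : w ^ q + w = h) (r : ℕ) :
    artinSchreierSum q h r = w - (-1) ^ r * w ^ q ^ r := by
  have hpow : ∀ i, h ^ q ^ i = w ^ q ^ (i + 1) + w ^ q ^ i := by
    intro i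
    induction i with
    | zero => simp [← hw]
    | succ i ih => rw [pow_succ, pow_mul, ih, hadd, ← pow_mul, ← pow_mul, ← pow_succ, ← pow_succ]
  induction r with
  | zero => simp [artinSchreierSum]
  | succ r ih =>
    rw [artinSchreierSum, Finset.sum_range_succ, ← artinSchreierSum, ih, hpow]
    ring

end CommRing

theorem add_pow_card {F : Type*} [Field F] [Fintype F] {q : ℕ} (hq : IsPrimePow q)
    (hF : Fintype.card F = q ^ 2) (B : Type*) [CommRing B] [Algebra F B] (a b : B) :
    (a + b) ^ q = a ^ q + b ^ q := by
  cases subsingleton_or_nontrivial B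
  · exact Subsingleton.elim _ _
  obtain ⟨p, k, hp, hk, rfl⟩ := hq
  have hp' : p.Prime := hp.nat_prime
  have : Fact p.Prime := ⟨hp'⟩
  obtain ⟨p', hc⟩ := CharP.exists F
  obtain ⟨m, hm', hm⟩ := FiniteField.card F p'
  have hpp : p' = p := by
    have h1 : p' ∣ (p ^ k) ^ 2 := by
      rw [← hF, hm]
      exact dvd_pow_self _ m.ne_zero
    exact (Nat.prime_dvd_prime_iff_eq hm' hp').mp
      (hm'.dvd_of_dvd_pow (hm'.dvd_of_dvd_pow h1))
  subst hpp
  have : CharP B p' := charP_of_injective_algebraMap (algebraMap F B).injective p'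
  exact add_pow_char_pow a b p' k

/-! ### Homomorphisms out of the coordinate ring, and evaluation at points -/

section CoordRing

variable {F : Type*} [Field F] {q : ℕ}

/-- The coordinate function `x` on the surface `H × 𝔸¹`. -/
def coordX (F : Type*) [Field F] (q : ℕ) : (CoordRing F q)[X] := C (AdjoinRoot.of _ X)

/-- The coordinate function `y` on the surface `H × 𝔸¹`. -/
def coordY (F : Type*) [Field F] (q : ℕ) : (CoordRing F q)[X] := C (AdjoinRoot.root _)

theorem coord_equation :
    coordY F q ^ q + coordY F q = coordX F q ^ (q + 1) := by
  have h : AdjoinRoot.mk (curvePoly F q) (X ^ q + X - C (X ^ (q + 1))) = 0 := AdjoinRoot.mk_self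
  simp only [map_sub, map_add, map_pow, AdjoinRoot.mk_X, AdjoinRoot.mk_C] at h
  simp only [coordX, coordY, ← C_pow, ← C_add]
  rw [sub_eq_zero.mp h]

theorem algebraMap_surface (a : F) :
    algebraMap F (CoordRing F q)[X] a = C (AdjoinRoot.of _ (C a)) := rfl

variable {B : Type*} [CommRing B] [Algebra F B]

theorem surface_algHom_ext {f g : (CoordRing F q)[X] →ₐ[F] B}
    (hx : f (coordX F q) = g (coordX F q)) (hy : f (coordY F q) = g (coordY F q))
    (hz : f X = g X) : f = g := by
  have h : (f : (CoordRing F q)[X] →+* B) = g := by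
    refine Polynomial.ringHom_ext' ?_ hz
    refine AdjoinRoot.ringHom_ext ?_ hy
    refine Polynomial.ringHom_ext' ?_ hx
    ext a
    exact (f.commutes a).trans (g.commutes a).symm
  exact AlgHom.ext fun a => RingHom.congr_fun h a

theorem surface_algHom_sub_mem {f g : (CoordRing F q)[X] →ₐ[F] B} (I : Ideal B)
    (hx : f (coordX F q) - g (coordX F q) ∈ I) (hy : f (coordY F q) - g (coordY F q) ∈ I)
    (hz : f X - g X ∈ I) (a : (CoordRing F q)[X]) : f a - g a ∈ I := by
  have h : (Ideal.Quotient.mkₐ F I).comp f = (Ideal.Quotient.mkₐ F I).comp g :=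
    surface_algHom_ext (Ideal.Quotient.eq.mpr hx) (Ideal.Quotient.eq.mpr hy)
      (Ideal.Quotient.eq.mpr hz)
  exact Ideal.Quotient.eq.mp (DFunLike.congr_fun h a)

/-- The homomorphism from the coordinate ring of `H × 𝔸¹` determined by a point of the surface with
coordinates in an `F`-algebra. -/
def surfaceLift (x y z : B) (h : y ^ q + y = x ^ (q + 1)) : (CoordRing F q)[X] →ₐ[F] B where
  toRingHom := eval₂RingHom
    (AdjoinRoot.lift (eval₂RingHom (algebraMap F B) x) y
      (by simp only [curvePoly, eval₂_sub, eval₂_add, eval₂_X_pow, eval₂_X, eval₂_C,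
        coe_eval₂RingHom, h, sub_self])) z
  commutes' a := by
    change eval₂RingHom _ _ (C (AdjoinRoot.of _ (C a))) = _
    simp

section lift

variable (x y z : B) (h : y ^ q + y = x ^ (q + 1))

theorem surfaceLift_coordX : surfaceLift (F := F) x y z h (coordX F q) = x := by
  change eval₂RingHom _ _ (C (AdjoinRoot.of _ X)) = _
  simp

theorem surfaceLift_coordY : surfaceLift (F := F) x y z h (coordY F q) = y := by
  change eval₂RingHom _ _ (C (AdjoinRoot.root _)) = _
  simp

theorem surfaceLift_X : surfaceLift (F := F) x y z h X = z := by
  change eval₂RingHom _ _ X = _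
  simp

end lift

variable (P : RatPoint F q) (γ : F)

theorem surfaceEval_coordX : surfaceEval P γ (coordX F q) = P.1.1 := by
  simp [surfaceEval, coordX, evalAt]

theorem surfaceEval_coordY : surfaceEval P γ (coordY F q) = P.1.2 := by
  simp [surfaceEval, coordY, evalAt]

theorem surfaceEval_X : surfaceEval P γ X = γ := by
  simp [surfaceEval]

theorem surfaceEval_algebraMap (a : F) : surfaceEval P γ (algebraMap F _ a) = a := by
  rw [algebraMap_surface, surfaceEval, coe_eval₂RingHom, eval₂_C, evalAt, AdjoinRoot.lift_of,
    coe_evalRingHom, eval_C]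

/-- Evaluation at a point, as a homomorphism of `F`-algebras. -/
def surfaceEvalAlgHom : (CoordRing F q)[X] →ₐ[F] F where
  toRingHom := surfaceEval P γ
  commutes' := surfaceEval_algebraMap P γ

instance maxIdeal_isMaximal : (maxIdeal P γ).IsMaximal :=
  RingHom.ker_isMaximal_of_surjective _ fun a => ⟨_, surfaceEval_algebraMap P γ a⟩

theorem sub_mem_maxIdeal (f : (CoordRing F q)[X]) (a : F) (h : surfaceEval P γ f = a) :
    f - algebraMap F _ a ∈ maxIdeal P γ := by
  rw [maxIdeal, RingHom.mem_ker, map_sub, surfaceEval_algebraMap, h, sub_self]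

theorem maxIdeal_injective :
    Function.Injective fun S : RatPoint F q × F => maxIdeal S.1 S.2 := by
  rintro ⟨P, γ⟩ ⟨Q, δ⟩ (h : maxIdeal P γ = maxIdeal Q δ)
  have key : ∀ f, surfaceEval Q δ f = surfaceEval P γ f := by
    intro f
    have h1 := sub_mem_maxIdeal P γ f _ rfl
    rwa [h, maxIdeal, RingHom.mem_ker, map_sub, surfaceEval_algebraMap, sub_eq_zero] at h1
  have hx := key (coordX F q)
  have hy := key (coordY F q)
  have hz := key X
  rw [surfaceEval_coordX, surfaceEval_coordX] at hx
  rw [surfaceEval_coordY, surfaceEval_coordY] at hy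
  rw [surfaceEval_X, surfaceEval_X] at hz
  exact Prod.ext (Subtype.ext (Prod.ext hx.symm hy.symm)) hz.symm

end CoordRing

/-! ### Dimension of the truncated polynomial ring -/

section Truncated

variable (F : Type*) [Field F]

/-- The truncated polynomial ring `F[s,t] / (s,t) ^ r`. -/
abbrev Trunc (r : ℕ) : Type _ :=
  MvPolynomial (Fin 2) F ⧸ MvPolynomial.idealOfVars (Fin 2) F ^ r

/-- Bivariate exponents of degree less than `r`, sorted by their degree. -/
def degreeLTEquiv (r : ℕ) : {d : Fin 2 →₀ ℕ // d.degree < r} ≃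
    (Finset.range r).sigma fun k => Finset.HasAntidiagonal.antidiagonal k where
  toFun d := ⟨⟨d.1.degree, (d.1 0, d.1 1)⟩, Finset.mem_sigma.mpr
    ⟨Finset.mem_range.mpr d.2, Finset.HasAntidiagonal.mem_antidiagonal.mpr
      (by simp [Finsupp.degree_eq_sum, Fin.sum_univ_two])⟩⟩
  invFun s := ⟨Finsupp.equivFunOnFinite.symm ![s.1.2.1, s.1.2.2], by
    have h := s.2
    simp only [Finset.mem_sigma, Finset.mem_range,
      Finset.HasAntidiagonal.mem_antidiagonal] at h
    simp [Finsupp.degree_eq_sum, Fin.sum_univ_two, h.2, h.1]⟩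
  left_inv := by
    rintro ⟨d, hd⟩
    ext i
    fin_cases i <;> simp
  right_inv := by
    rintro ⟨⟨k, a, b⟩, hs⟩
    have h := hs
    simp only [Finset.mem_sigma, Finset.mem_range,
      Finset.HasAntidiagonal.mem_antidiagonal] at h
    obtain ⟨-, rfl⟩ := h
    simp [Finsupp.degree_eq_sum, Fin.sum_univ_two]

theorem card_degree_lt (r : ℕ) :
    Nat.card {d : Fin 2 →₀ ℕ // d.degree < r} = (r + 1).choose 2 := by
  rw [Nat.card_congr (degreeLTEquiv r), Nat.card_eq_fintype_card, Fintype.card_coe,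
    Finset.card_sigma]
  simp only [Finset.Nat.card_antidiagonal]
  -- Degree `k` contributes `k + 1` monomials; the index shift splits off the zero term of `0 + 1 +
  -- ⋯ + r`.
  rw [Nat.choose_two_right, ← Finset.sum_range_id, Finset.sum_range_succ', add_zero]

instance finite_degree_lt (r : ℕ) : Finite {d : Fin 2 →₀ ℕ // d.degree < r} :=
  Finite.of_equiv _ (degreeLTEquiv r).symm

/-- The coefficients of the monomials of degree less than `r`. -/
def lowCoeffs (r : ℕ) :
    MvPolynomial (Fin 2) F →ₗ[F] ({d : Fin 2 →₀ ℕ // d.degree < r} → F) :=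
  LinearMap.pi fun d => MvPolynomial.lcoeff F d.1

theorem lowCoeffs_surjective (r : ℕ) : Function.Surjective (lowCoeffs F r) := by
  have := Fintype.ofFinite {d : Fin 2 →₀ ℕ // d.degree < r}
  classical
  intro c
  refine ⟨∑ d, MvPolynomial.monomial d.1 (c d), ?_⟩
  ext e
  simp [lowCoeffs, MvPolynomial.coeff_monomial, Subtype.val_inj]

theorem ker_lowCoeffs (r : ℕ) :
    LinearMap.ker (lowCoeffs F r) =
      (MvPolynomial.idealOfVars (Fin 2) F ^ r).restrictScalars F := by
  ext f
  rw [Submodule.restrictScalars_mem, MvPolynomial.mem_pow_idealOfVars_iff', LinearMap.mem_ker,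
    funext_iff]
  exact ⟨fun h d hd => h ⟨d, hd⟩, fun h d => h d.1 d.2⟩

/-- The truncated polynomial ring is described by the coefficients of low degree. -/
def truncEquiv (r : ℕ) : Trunc F r ≃ₗ[F] ({d : Fin 2 →₀ ℕ // d.degree < r} → F) :=
  (Submodule.Quotient.restrictScalarsEquiv F (MvPolynomial.idealOfVars (Fin 2) F ^ r)).symm ≪≫ₗ
    Submodule.quotEquivOfEq _ _ (ker_lowCoeffs F r).symm ≪≫ₗ
    (lowCoeffs F r).quotKerEquivOfSurjective (lowCoeffs_surjective F r)

instance trunc_finite (r : ℕ) : Module.Finite F (Trunc F r) :=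
  Module.Finite.equiv (truncEquiv F r).symm

theorem finrank_trunc (r : ℕ) : Module.finrank F (Trunc F r) = (r + 1).choose 2 := by
  have := Fintype.ofFinite {d : Fin 2 →₀ ℕ // d.degree < r}
  rw [(truncEquiv F r).finrank_eq, Module.finrank_pi, ← Nat.card_eq_fintype_card, card_degree_lt]

/-- The image of the ideal of the variables in the truncated polynomial ring. -/
def truncIdeal (r : ℕ) : Ideal (Trunc F r) :=
  (MvPolynomial.idealOfVars (Fin 2) F).map (Ideal.Quotient.mk _)

theorem truncIdeal_pow (r : ℕ) : truncIdeal F r ^ r = ⊥ := by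
  rw [truncIdeal, ← Ideal.map_pow, Ideal.map_quotient_self]

/-- The image of a variable in the truncated polynomial ring. -/
def truncVar (r : ℕ) (i : Fin 2) : Trunc F r := Ideal.Quotient.mk _ (MvPolynomial.X i)

theorem truncVar_mem (r : ℕ) (i : Fin 2) : truncVar F r i ∈ truncIdeal F r :=
  Ideal.mem_map_of_mem _ (Ideal.subset_span ⟨i, rfl⟩)

end Truncated

/-- The increment of the norm function `x ^ (q + 1)`. -/
def normIncr {B : Type*} [CommRing B] (q : ℕ) (a s : B) : B := (a + s) ^ (q + 1) - a ^ (q + 1)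

theorem normIncr_mem {B : Type*} [CommRing B] (q : ℕ) (a : B) {s : B} {I : Ideal B} (hs : s ∈ I) :
    normIncr q a s ∈ I := by
  have h := sub_dvd_pow_sub_pow (a + s) a (q + 1)
  rw [add_sub_cancel_left] at h
  exact I.mem_of_dvd h hs

/-! ### Taylor expansion at one point -/

section Local

variable {F : Type*} [Field F] {q : ℕ} (P : RatPoint F q) (γ : F) (r : ℕ)

/-- The expansion of `y` in terms of the local parameter `s` at the point `P`. -/
def localY : Trunc F r :=
  algebraMap F _ P.1.2 +
    artinSchreierSum q (normIncr q (algebraMap F _ P.1.1) (truncVar F r 0)) r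

/-- The homomorphism from the polynomial ring given by the local parameters at `(P, γ)`. -/
def localParams : MvPolynomial (Fin 2) F →ₐ[F] (CoordRing F q)[X] :=
  MvPolynomial.aeval ![coordX F q - algebraMap F _ P.1.1, X - algebraMap F _ γ]

theorem idealOfVars_pow_le_comap :
    MvPolynomial.idealOfVars (Fin 2) F ^ r ≤
      (maxIdeal P γ ^ r).comap (localParams P γ).toRingHom := by
  rw [← Ideal.map_le_iff_le_comap, Ideal.map_pow]
  refine Ideal.pow_right_mono (Ideal.map_le_iff_le_comap.mpr (Ideal.span_le.mpr ?_)) r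
  rintro _ ⟨i, rfl⟩
  change localParams P γ (MvPolynomial.X i) ∈ maxIdeal P γ
  rw [localParams, MvPolynomial.aeval_X]
  fin_cases i
  · exact sub_mem_maxIdeal P γ _ _ (surfaceEval_coordX P γ)
  · exact sub_mem_maxIdeal P γ _ _ (surfaceEval_X P γ)

/-- Substitution of the local parameters, modulo the `r`-th power of the maximal ideal. -/
def truncLocalParams : Trunc F r →ₐ[F] (CoordRing F q)[X] ⧸ maxIdeal P γ ^ r :=
  Ideal.Quotient.liftₐ _ ((Ideal.Quotient.mkₐ F _).comp (localParams P γ)) fun _ ha =>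
    Ideal.Quotient.eq_zero_iff_mem.mpr (idealOfVars_pow_le_comap P γ r ha)

theorem truncLocalParams_truncVar (i : Fin 2) :
    truncLocalParams P γ r (truncVar F r i) =
      Ideal.Quotient.mkₐ F _
        (![coordX F q - algebraMap F _ P.1.1, X - algebraMap F _ γ] i) := by
  change Ideal.Quotient.mkₐ F _ (localParams P γ (MvPolynomial.X i)) = _
  rw [localParams, MvPolynomial.aeval_X]

theorem truncLocalParams_localY_eq :
    truncLocalParams P γ r (localY P r) =
      algebraMap F _ P.1.2 + artinSchreierSum q (normIncr q (algebraMap F _ P.1.1)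
        (Ideal.Quotient.mkₐ F _ (coordX F q - algebraMap F _ P.1.1))) r := by
  have h0 := truncLocalParams_truncVar P γ r 0
  simp only [Matrix.cons_val_zero] at h0
  simp only [localY, artinSchreierSum, normIncr, map_add, AlgHom.commutes, map_sum, map_mul,
    map_pow, map_neg, map_one, map_sub, h0]

variable [Fintype F] (hq : IsPrimePow q) (hF : Fintype.card F = q ^ 2)

include hq hF in
theorem localY_equation :
    localY P r ^ q + localY P r = (algebraMap F _ P.1.1 + truncVar F r 0) ^ (q + 1) := by
  have hadd := add_pow_card hq hF (Trunc F r)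
  have h := artinSchreierSum_pow_add hq.ne_zero hadd
    (normIncr q (algebraMap F _ P.1.1) (truncVar F r 0)) r
  have h0 := pow_mem_pow_of_mem hq.one_lt
    (normIncr_mem q (algebraMap F _ P.1.1) (truncVar_mem F r 0)) r
  rw [truncIdeal_pow, Ideal.mem_bot] at h0
  have hP := congrArg (algebraMap F (Trunc F r)) P.2
  simp only [map_add, map_pow] at hP
  rw [h0, mul_zero, sub_zero] at h
  rw [localY, hadd]
  -- Only the right-hand side is unfolded; the two increments inside the sums stay intact.
  nth_rw 3 [normIncr] at h
  linear_combination h + hP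

/-- The Taylor expansion of order `r` at the point `(P, γ)`. -/
def taylor : (CoordRing F q)[X] →ₐ[F] Trunc F r :=
  surfaceLift (algebraMap F _ P.1.1 + truncVar F r 0) (localY P r)
    (algebraMap F _ γ + truncVar F r 1) (localY_equation P r hq hF)

theorem taylor_sub_mem (f : (CoordRing F q)[X]) :
    taylor P γ r hq hF f - algebraMap F _ (surfaceEval P γ f) ∈ truncIdeal F r := by
  refine surface_algHom_sub_mem (f := taylor P γ r hq hF)
    (g := (Algebra.ofId F (Trunc F r)).comp (surfaceEvalAlgHom P γ)) (truncIdeal F r) ?_ ?_ ?_ f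
  · change taylor P γ r hq hF _ - algebraMap F _ (surfaceEval P γ _) ∈ _
    rw [taylor, surfaceLift_coordX, surfaceEval_coordX, add_sub_cancel_left]
    exact truncVar_mem F r 0
  · change taylor P γ r hq hF _ - algebraMap F _ (surfaceEval P γ _) ∈ _
    rw [taylor, surfaceLift_coordY, surfaceEval_coordY, localY, add_sub_cancel_left]
    exact artinSchreierSum_mem hq.ne_zero (normIncr_mem q _ (truncVar_mem F r 0)) r
  · change taylor P γ r hq hF _ - algebraMap F _ (surfaceEval P γ _) ∈ _
    rw [taylor, surfaceLift_X, surfaceEval_X, add_sub_cancel_left]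
    exact truncVar_mem F r 1

theorem taylor_comp_localParams :
    (taylor P γ r hq hF).comp (localParams P γ) = Ideal.Quotient.mkₐ F _ := by
  refine MvPolynomial.algHom_ext fun i => ?_
  rw [AlgHom.comp_apply, localParams, MvPolynomial.aeval_X]
  fin_cases i
  · change taylor P γ r hq hF (coordX F q - algebraMap F _ P.1.1) = truncVar F r 0
    rw [map_sub, AlgHom.commutes, taylor, surfaceLift_coordX, add_sub_cancel_left]
  · change taylor P γ r hq hF (X - algebraMap F _ γ) = truncVar F r 1
    rw [map_sub, AlgHom.commutes, taylor, surfaceLift_X, add_sub_cancel_left]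

theorem taylor_surjective : Function.Surjective (taylor P γ r hq hF) := by
  intro b
  obtain ⟨f, rfl⟩ := Ideal.Quotient.mk_surjective b
  exact ⟨localParams P γ f, DFunLike.congr_fun (taylor_comp_localParams P γ r hq hF) f⟩

-- Modulo `𝔪_S ^ r` the class of `y - β` solves the same additive equation and has vanishing `q ^
-- r`-th power, so uniqueness identifies it with the sum in `localY`.
include hq hF in
theorem truncLocalParams_localY :
    truncLocalParams P γ r (localY P r) = Ideal.Quotient.mkₐ F _ (coordY F q) := by
  have hadd := add_pow_card hq hF ((CoordRing F q)[X] ⧸ maxIdeal P γ ^ r)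
  set π := Ideal.Quotient.mkₐ F (maxIdeal P γ ^ r)
  have hw : π (coordY F q - algebraMap F _ P.1.2) ^ q + π (coordY F q - algebraMap F _ P.1.2) =
      normIncr q (algebraMap F _ P.1.1) (π (coordX F q - algebraMap F _ P.1.1)) := by
    have h1 := hadd (π (coordY F q - algebraMap F _ P.1.2)) (algebraMap F _ P.1.2)
    have h2 := congrArg π (coord_equation (F := F) (q := q))
    have h3 := congrArg (algebraMap F ((CoordRing F q)[X] ⧸ maxIdeal P γ ^ r)) P.2
    simp only [map_add, map_pow, map_sub, AlgHom.commutes, sub_add_cancel] at h1 h2 h3 ⊢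
    rw [normIncr, add_sub_cancel]
    linear_combination h2 - h1 - h3
  have h0 : π (coordY F q - algebraMap F _ P.1.2) ^ q ^ r = 0 := by
    rw [← map_pow]
    exact Ideal.Quotient.eq_zero_iff_mem.mpr (pow_mem_pow_of_mem hq.one_lt
      (sub_mem_maxIdeal P γ _ _ (surfaceEval_coordY P γ)) r)
  rw [truncLocalParams_localY_eq, eq_artinSchreierSum hadd hw, h0, mul_zero, sub_zero,
    map_sub, AlgHom.commutes, add_sub_cancel]

theorem truncLocalParams_comp_taylor :
    (truncLocalParams P γ r).comp (taylor P γ r hq hF) = Ideal.Quotient.mkₐ F _ := by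
  have h0 := truncLocalParams_truncVar P γ r 0
  have h1 := truncLocalParams_truncVar P γ r 1
  simp only [Matrix.cons_val_zero, Matrix.cons_val_one, map_sub, AlgHom.commutes] at h0 h1
  refine surface_algHom_ext ?_ ?_ ?_ <;> rw [AlgHom.comp_apply, taylor]
  · rw [surfaceLift_coordX, map_add, AlgHom.commutes, h0, add_sub_cancel]
  · rw [surfaceLift_coordY, truncLocalParams_localY P γ r hq hF]
  · rw [surfaceLift_X, map_add, AlgHom.commutes, h1, add_sub_cancel]

/-- `truncLocalParams` recovers the class of `f` from its expansion; conversely `taylor` sends `𝔪_S`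
into `truncIdeal`, whose `r`-th power is zero. -/
theorem taylor_eq_zero_iff (f : (CoordRing F q)[X]) :
    taylor P γ r hq hF f = 0 ↔ f ∈ maxIdeal P γ ^ r := by
  constructor
  · intro h
    have h1 := DFunLike.congr_fun (truncLocalParams_comp_taylor P γ r hq hF) f
    rw [AlgHom.comp_apply, h, map_zero] at h1
    exact Ideal.Quotient.eq_zero_iff_mem.mp h1.symm
  · intro h
    have h1 : maxIdeal P γ ≤ (truncIdeal F r).comap (taylor P γ r hq hF).toRingHom := by
      intro g hg
      have h2 := taylor_sub_mem P γ r hq hF g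
      rw [maxIdeal, RingHom.mem_ker] at hg
      rwa [hg, map_zero, sub_zero] at h2
    have h3 := (Ideal.pow_right_mono h1 r).trans (Ideal.le_comap_pow _ r) h
    rw [truncIdeal_pow] at h3
    exact h3

end Local

/-! ### Gluing the local expansions -/

section Global

variable {F : Type*} [Field F] [Fintype F] {q : ℕ} (hq : IsPrimePow q)
  (hF : Fintype.card F = q ^ 2) {n : ℕ} (P : Fin n → RatPoint F q) (M : Fin n → F → ℕ)

/-- The Taylor expansions at all the points `(P i, γ)`, to the orders given by `M`. -/
def multiTaylor : (CoordRing F q)[X] →ₗ[F] ((s : Fin n × F) → Trunc F (M s.1 s.2)) :=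
  LinearMap.pi fun s => (taylor (P s.1) s.2 (M s.1 s.2) hq hF).toLinearMap

theorem ker_multiTaylor :
    LinearMap.ker (multiTaylor hq hF P M) = (interpIdeal P M).restrictScalars F := by
  ext f
  rw [LinearMap.mem_ker, funext_iff, Submodule.restrictScalars_mem]
  change (∀ s : Fin n × F, taylor (P s.1) s.2 (M s.1 s.2) hq hF f = 0) ↔
    ∀ i γ, (M i γ : ℕ∞) ≤ mult (P i) γ f
  simp only [taylor_eq_zero_iff, le_mult_iff, Prod.forall]

theorem multiTaylor_surjective (hP : Function.Injective P) :
    Function.Surjective (multiTaylor hq hF P M) := by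
  intro b
  choose g hg using fun s : Fin n × F =>
    taylor_surjective (P s.1) s.2 (M s.1 s.2) hq hF (b s)
  -- Distinct maximal ideals are coprime, hence so are their powers; injectivity of `P` keeps them
  -- distinct.
  have hcop : Pairwise (Function.onFun IsCoprime
      fun s : Fin n × F => maxIdeal (P s.1) s.2 ^ M s.1 s.2) := by
    intro s t hst
    refine (Ideal.isCoprime_of_isMaximal fun h => hst ?_).pow
    have h1 := Prod.ext_iff.mp (@maxIdeal_injective F _ q (P s.1, s.2) (P t.1, t.2) h)
    exact Prod.ext (hP h1.1) h1.2
  obtain ⟨f, hf⟩ := Ideal.pi_quotient_surjective hcop fun s => Ideal.Quotient.mk _ (g s)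
  refine ⟨f, funext fun s => ?_⟩
  change taylor (P s.1) s.2 (M s.1 s.2) hq hF f = b s
  rw [← hg s, ← sub_eq_zero, ← map_sub, taylor_eq_zero_iff, ← Ideal.Quotient.eq]
  exact hf s

/-- The quotient by the interpolation ideal is the product of the truncated polynomial rings. -/
def quotientInterpEquiv (hP : Function.Injective P) :
    ((CoordRing F q)[X] ⧸ interpIdeal P M) ≃ₗ[F] ((s : Fin n × F) → Trunc F (M s.1 s.2)) :=
  (Submodule.Quotient.restrictScalarsEquiv F (interpIdeal P M)).symm ≪≫ₗ
    Submodule.quotEquivOfEq _ _ (ker_multiTaylor hq hF P M).symm ≪≫ₗ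
    (multiTaylor hq hF P M).quotKerEquivOfSurjective (multiTaylor_surjective hq hF P M hP)

end Global

end Hermitian

end

theorem mainTheorem5 {F : Type*} [Field F] [Fintype F] (q : ℕ) (hq : IsPrimePow q)
    (hF : Fintype.card F = q ^ 2) (n : ℕ) (P : Fin n ≃ Hermitian.RatPoint F q)
    (M : Fin n → F → ℕ) :
    Module.Finite F
        (Polynomial (Hermitian.CoordRing F q) ⧸ Hermitian.interpIdeal P M) ∧
      Module.finrank F
          (Polynomial (Hermitian.CoordRing F q) ⧸ Hermitian.interpIdeal P M) =
        ∑ i : Fin n, ∑ γ : F, (M i γ + 1).choose 2 := by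
  let e := Hermitian.quotientInterpEquiv hq hF P M P.injective
  refine ⟨Module.Finite.equiv e.symm, ?_⟩
  rw [e.finrank_eq, Module.finrank_pi_fintype, Fintype.sum_prod_type]
  simp only [Hermitian.finrank_trunc]
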